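/- Let $X,Y$ be real Hilbert spaces, let $f:X\to\mathbb{R}\cup\{\pm\infty\}$ and $g:Y\to\mathbb{R}\cup\{\pm\infty\}$ be proper, convex and lower semicontinuous, and let $K:X\to Y$ be linear and continuous with adjoint $K^*$. Write $\operatorname{dom} f=\{x: f(x)<+\infty\}$, $f^*(u)=\sup_{x\in X}\{\langle u,x\rangle-f(x)\}$, $\partial f(x)=\{u: f(z)\ge f(x)+\langle u,z-x\rangle\ \forall z\in X\}$ if $f(x)\in\mathbb{R}$ and $\partial f(x)=\emptyset$ otherwise, and, for $\gamma>0$, let $\operatorname{prox}_{\gamma f}(x)$ be the unique minimizer of $z\mapsto f(z)+\frac1{2\gamma}\|z-x\|^2$ (similarly on $Y$). For a convex set $C\subseteq Y$ let $\operatorname{sqri} C$ be the set of those $c\in C$ for which $\bigcup_{\lambda>0}\lambda(C-c)$ is a closed linear subspace of $Y$. Consider the primal problem $$\inf_{x\in X}\{f(x)+g(Kx)\}\qquad (P)$$ and its Fenchel dual $$\sup_{y\in Y}\{-f^*(-K^*y)-g^*(y)\}.\qquad (D)$$ Assume that $(P)$ has an optimal solution $\hat x$ and that one of the following qualification conditions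 holds: $(QC_1)$ there is $x'\in\operatorname{dom} f\cap K^{-1}(\operatorname{dom} g)$ such that $g$ is continuous at $Kx'$; $(QC_2)$ $0\in\operatorname{int}(\operatorname{dom} g-K(\operatorname{dom} f))$; $(QC_3)$ $0\in\operatorname{sqri}(\operatorname{dom} g-K(\operatorname{dom} f))$. Then the following statements are true. (i) There exists an optimal solution $\hat y\in Y$ of $(D)$, the optimal objective values of $(P)$ and $(D)$ coincide, and $$K\hat x\in\partial g^*(\hat y)\quad\text{and}\quad -K^*\hat y\in\partial f(\hat x).$$ Moreover, let $\sigma,\tau>0$ with $\sigma\tau\|K\|^2<1$ and $(x^0,y^0)\in X\times Y$ be arbitrary, put $\bar x^0:=x^0$, and for $n\ge 0$ let $$y^{n+1}:=\operatorname{prox}_{\sigma g^*}(y^n+\sigma K\bar x^n),\qquad x^{n+1}:=\operatorname{prox}_{\tau f}(x^n-\tau K^*y^{n+1}),\qquad \bar x^{n+1}:=2x^{n+1}-x^n.$$ (ii) For every optimal solution $\hat y$ of $(D)$ and every $n\ge0$, $$\frac{\|x^n-\hat x\|^2}{2\tau}+(1-\sigma\tau\|K\|^2)\frac{\|y^n-\hat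 y\|^2}{2\sigma}\le\frac{\|x^0-\hat x\|^2}{2\tau}+\frac{\|y^0-\hat y\|^2}{2\sigma};$$ in particular, the sequence $(x^n,y^n)_{n\ge0}$ is bounded. (iii) If $X$ and $Y$ are finite-dimensional, then $(x^n)_{n\ge0}$ converges to an optimal solution of $(P)$ and $(y^n)_{n\ge0}$ converges to an optimal solution of $(D)$. -/

import Mathlib

open scoped Pointwise

namespace ConvexDuality

noncomputable section

variable {X : Type*} [NormedAddCommGroup X] [InnerProductSpace ℝ X]
variable {Y : Type*} [NormedAddCommGroup Y] [InnerProductSpace ℝ Y]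

/-- The effective domain of an extended real valued function. -/
def effDom (f : X → EReal) : Set X := {x | f x < ⊤}

/-- Proper, convex (the epigraph is a convex set) and lower semicontinuous functions. -/
structure ProperConvexLsc (f : X → EReal) : Prop where
  dom_nonempty : (effDom f).Nonempty
  ne_bot : ∀ x, f x ≠ ⊥
  convex_epigraph : Convex ℝ {p : X × ℝ | f p.1 ≤ (p.2 : EReal)}
  lsc : LowerSemicontinuous f

/-- The conjugate `f*(u) = sup_x {⟨u, x⟩ - f x}`. -/
def conj (f : X → EReal) (u : X) : EReal := ⨆ x : X, (((inner ℝ u x : ℝ) : EReal) - f x)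

/-- The convex subdifferential, empty at the points where `f` is not finite. -/
def subdiff (f : X → EReal) (x : X) : Set X :=
  {u | f x ≠ ⊤ ∧ f x ≠ ⊥ ∧ ∀ z : X, f x + ((inner ℝ u (z - x) : ℝ) : EReal) ≤ f z}

/-- The strong quasi-relative interior: the points `x ∈ C` for which the cone
`⋃_{t > 0} t (C - x)` is a closed linear subspace. -/
def sqri (C : Set X) : Set X :=
  {x | x ∈ C ∧ ∃ V : Submodule ℝ X, IsClosed (V : Set X) ∧
    (⋃ t ∈ Set.Ioi (0 : ℝ), t • (C - {x})) = (V : Set X)}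

/-- `p` is the proximal point of parameter `γ` of `f` at `x`, i.e. it minimizes
`z ↦ f z + ‖z - x‖² / (2γ)`. -/
def IsProx (γ : ℝ) (f : X → EReal) (x p : X) : Prop :=
  ∀ z : X, f p + ((‖p - x‖ ^ 2 / (2 * γ) : ℝ) : EReal) ≤
    f z + ((‖z - x‖ ^ 2 / (2 * γ) : ℝ) : EReal)

/-- The primal objective `x ↦ f x + g (K x)`. -/
def primalObj (f : X → EReal) (g : Y → EReal) (K : X →L[ℝ] Y) (x : X) : EReal :=
  f x + g (K x)

/-- The objective `y ↦ -f*(-K* y) - g*(y)` of the Fenchel dual. -/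
def dualObj [CompleteSpace X] [CompleteSpace Y]
    (f : X → EReal) (g : Y → EReal) (K : X →L[ℝ] Y) (y : Y) : EReal :=
  -conj f (-(ContinuousLinearMap.adjoint K y)) - conj g y

/-- `x` is an optimal solution of the primal problem. -/
def IsPrimalOptimal (f : X → EReal) (g : Y → EReal) (K : X →L[ℝ] Y) (x : X) : Prop :=
  ∀ z : X, primalObj f g K x ≤ primalObj f g K z

/-- `y` is an optimal solution of the Fenchel dual problem. -/
def IsDualOptimal [CompleteSpace X] [CompleteSpace Y]
    (f : X → EReal) (g : Y → EReal) (K : X →L[ℝ] Y) (y : Y) : Prop :=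
  ∀ z : Y, dualObj f g K z ≤ dualObj f g K y

/-- `g` is continuous at some point `K x'` with `x' ∈ dom f ∩ K⁻¹(dom g)`. -/
def QC1 (f : X → EReal) (g : Y → EReal) (K : X →L[ℝ] Y) : Prop :=
  ∃ x' : X, x' ∈ effDom f ∩ K ⁻¹' effDom g ∧ ContinuousAt g (K x')

/-- `0 ∈ int (dom g - K (dom f))`. -/
def QC2 (f : X → EReal) (g : Y → EReal) (K : X →L[ℝ] Y) : Prop :=
  (0 : Y) ∈ interior (effDom g - K '' effDom f)

/-- `0 ∈ sqri (dom g - K (dom f))`. -/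
def QC3 (f : X → EReal) (g : Y → EReal) (K : X →L[ℝ] Y) : Prop :=
  (0 : Y) ∈ sqri (effDom g - K '' effDom f)

/-- The sequence `(xⁿ, x̄ⁿ, yⁿ)` is generated by the primal-dual algorithm with step
sizes `σ` (dual) and `τ` (primal), from the starting point `(x⁰, y⁰)`. -/
structure IsPrimalDualSeq [CompleteSpace X] [CompleteSpace Y]
    (f : X → EReal) (g : Y → EReal) (K : X →L[ℝ] Y) (σ τ : ℝ)
    (x xbar : ℕ → X) (y : ℕ → Y) : Prop where
  init : xbar 0 = x 0
  step_y : ∀ n, IsProx σ (conj g) (y n + σ • K (xbar n)) (y (n + 1))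
  step_x : ∀ n, IsProx τ f (x n - τ • ContinuousLinearMap.adjoint K (y (n + 1))) (x (n + 1))
  step_xbar : ∀ n, xbar (n + 1) = (2 : ℝ) • x (n + 1) - x n

end

end ConvexDuality

/-!
Perturb the primal problem to `inf_x (f x + g (K x + v))`. A dual solution is a slope of an affine
minorant of the value function that is exact at `v = 0`. The strong quasi-relative interior
condition makes `dom g - K (dom f)` absorbing in a closed subspace `V`. Bounded pieces of sublevel
sets are weakly compact, so differences of such pieces are closed, and Baire's theorem makes one of
them a neighbourhood of `0` in `V`. Hence the epigraph of the value function, restricted to `V`, has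
interior points above `v = 0`, and a supporting hyperplane provides the slope.

For the algorithm, both proximal steps are inclusions into monotone subdifferentials. Testing them
against a saddle point shows that a Lyapunov function decreases by a positive multiple of the
squared increments, since `√(σ τ) ‖K‖ < 1`. The increments therefore tend to zero and every cluster
point is a saddle point. Relative to that point the Lyapunov function is antitone and tends to zero
along a subsequence, hence along the whole sequence.
-/

namespace ConvexDuality

open Filter Topology

section FunctionalAnalysis

variable {E F : Type*} [NormedAddCommGroup E] [InnerProductSpace ℝ E] [CompleteSpace E]
  [NormedAddCommGroup F] [InnerProductSpace ℝ F] [CompleteSpace F]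

lemma inclusionInDoubleDualWeak_surjective :
    Function.Surjective (NormedSpace.inclusionInDoubleDualWeak ℝ E) := by
  intro Φ
  let ψ : StrongDual ℝ E :=
    { toFun := fun u => WeakDual.toStrongDual Φ (InnerProductSpace.toDual ℝ E u)
      map_add' := by simp
      map_smul' := by simp
      cont := by fun_prop }
  refine ⟨toWeakSpace ℝ E ((InnerProductSpace.toDual ℝ E).symm ψ), DFunLike.ext _ _ fun ℓ => ?_⟩
  obtain ⟨u, rfl⟩ := (InnerProductSpace.toDual ℝ E).surjective ℓ
  calc inner ℝ u ((InnerProductSpace.toDual ℝ E).symm ψ)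
      = inner ℝ ((InnerProductSpace.toDual ℝ E).symm ψ) u := real_inner_comm _ _
    _ = ψ u := InnerProductSpace.toDual_symm_apply

lemma isCompact_toWeakSpace_image {s : Set E} (hs : Convex ℝ s) (hclosed : IsClosed s)
    (hbdd : Bornology.IsBounded s) : IsCompact (toWeakSpace ℝ E '' s) := by
  have hcompact : IsCompact (closure (toWeakSpace ℝ E '' s)) := by
    refine NormedSpace.isCompact_closure_of_isBounded ℝ E _ ?_ ?_
    · rwa [Set.preimage_image_eq _ (toWeakSpace ℝ E).injective]
    · rw [inclusionInDoubleDualWeak_surjective.range_eq]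
      exact Set.subset_univ _
  rwa [← hs.toWeakSpace_closure ℝ, hclosed.closure_eq] at hcompact

lemma isClosed_sub_image {s : Set F} {t : Set E} (T : E →L[ℝ] F)
    (hs : Convex ℝ s) (hs' : IsClosed s) (hs_bdd : Bornology.IsBounded s)
    (ht : Convex ℝ t) (ht' : IsClosed t) (ht_bdd : Bornology.IsBounded t) :
    IsClosed (s - T '' t) := by
  have hcompact : IsCompact
      (toWeakSpace ℝ F '' s - WeakSpace.map T '' (toWeakSpace ℝ E '' t)) := by
    rw [sub_eq_add_neg]
    exact (isCompact_toWeakSpace_image hs hs' hs_bdd).add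
      ((isCompact_toWeakSpace_image ht ht' ht_bdd).image (WeakSpace.map T).continuous).neg
  have himage : WeakSpace.map T '' (toWeakSpace ℝ E '' t) = toWeakSpace ℝ F '' (T '' t) := by
    rw [Set.image_image, Set.image_image]
    rfl
  rw [himage, ← Set.image_sub] at hcompact
  have := hcompact.isClosed.preimage (toWeakSpaceCLM ℝ F).continuous
  rwa [show ⇑(toWeakSpaceCLM ℝ F) = toWeakSpace ℝ F from rfl,
    Set.preimage_image_eq _ (toWeakSpace ℝ F).injective] at this

lemma exists_forall_eq_inner_add_mul (φ : StrongDual ℝ (E × ℝ)) :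
    ∃ (w : E) (s : ℝ), ∀ (z : E) (r : ℝ), φ (z, r) = inner ℝ w z + s * r := by
  refine ⟨(InnerProductSpace.toDual ℝ E).symm (φ.comp (ContinuousLinearMap.inl ℝ E ℝ)),
    φ (0, 1), fun z r => ?_⟩
  have hsplit : ((z, r) : E × ℝ) = (z, 0) + r • (0, 1) := by simp
  rw [hsplit, map_add, map_smul, InnerProductSpace.toDual_symm_apply, smul_eq_mul, mul_comm r]
  rfl

end FunctionalAnalysis

section Baire

variable {E : Type*} [AddCommGroup E] [Module ℝ E] [TopologicalSpace E] [ContinuousSMul ℝ E]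
  {C : ℕ → Set E}

lemma exists_nonempty_interior_of_absorbing [BaireSpace E] (hmono : Monotone C)
    (hconv : ∀ n, Convex ℝ (C n)) (hclosed : ∀ n, IsClosed (C n))
    (habs : ∀ v, ∃ n, ∃ t : ℝ, 0 < t ∧ t • v ∈ C n) : ∃ n, (interior (C n)).Nonempty := by
  obtain ⟨n₀, t₀, -, h₀⟩ := habs 0
  rw [smul_zero] at h₀
  have hcover : ⋃ n : ℕ, (fun v : E => ((n : ℝ) + 1)⁻¹ • v) ⁻¹' C n = Set.univ := by
    refine Set.eq_univ_of_forall fun v => ?_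
    obtain ⟨n, t, ht, hv⟩ := habs v
    obtain ⟨m, hm⟩ := exists_nat_ge t⁻¹
    let k := max m (max n₀ n)
    have hk : t⁻¹ ≤ (k : ℝ) + 1 :=
      hm.trans ((Nat.cast_le.2 (le_max_left m _)).trans (le_add_of_nonneg_right zero_le_one))
    have hmem := (hconv k).smul_mem_of_zero_mem (t := ((k : ℝ) + 1)⁻¹ * t⁻¹)
      (hmono ((le_max_left _ _).trans (le_max_right _ _)) h₀)
      (hmono ((le_max_right _ _).trans (le_max_right _ _)) hv)
      ⟨by positivity, by rw [inv_mul_le_one₀ (by positivity)]; exact hk⟩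
    rw [smul_smul, inv_mul_cancel_right₀ ht.ne'] at hmem
    exact Set.mem_iUnion.2 ⟨k, hmem⟩
  have : Nonempty E := ⟨0⟩
  obtain ⟨n, v, hv⟩ := nonempty_interior_of_iUnion_of_closed
    (fun n => (hclosed n).preimage (continuous_const_smul _)) hcover
  have hn : ((n : ℝ) + 1)⁻¹ ≠ 0 := by positivity
  exact ⟨n, ((n : ℝ) + 1)⁻¹ • v,
    ((Homeomorph.smulOfNeZero _ hn).preimage_interior (C n)).superset hv⟩

lemma mem_nhds_zero_of_mem_interior [IsTopologicalAddGroup E] {s : Set E} (hs : Convex ℝ s)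
    {v : E} (hv : v ∈ interior s) {t : ℝ} (ht : 0 < t) (hneg : t • -v ∈ s) : s ∈ 𝓝 0 := by
  rw [← mem_interior_iff_mem_nhds]
  refine hs.openSegment_interior_self_subset_interior hv hneg
    ⟨t / (1 + t), 1 / (1 + t), by positivity, by positivity, by field_simp; ring, ?_⟩
  module

lemma exists_mem_nhds_zero_of_absorbing [IsTopologicalAddGroup E] [BaireSpace E]
    (hmono : Monotone C) (hconv : ∀ n, Convex ℝ (C n)) (hclosed : ∀ n, IsClosed (C n))
    (habs : ∀ v, ∃ n, ∃ t : ℝ, 0 < t ∧ t • v ∈ C n) : ∃ n, C n ∈ 𝓝 0 := by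
  obtain ⟨n, v, hv⟩ := exists_nonempty_interior_of_absorbing hmono hconv hclosed habs
  obtain ⟨k, t, ht, hk⟩ := habs (-v)
  exact ⟨max n k, mem_nhds_zero_of_mem_interior (hconv _)
    (interior_mono (hmono (le_max_left n k)) hv) ht (hmono (le_max_right n k) hk)⟩

end Baire

section ConvexAnalysis

variable {E : Type*} [NormedAddCommGroup E] [InnerProductSpace ℝ E] {f : E → EReal} {x u : E}

lemma ProperConvexLsc.exists_coe_of_lt_top (hf : ProperConvexLsc f) (hx : f x < ⊤) :
    ∃ a : ℝ, f x = a :=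
  ⟨(f x).toReal, (EReal.coe_toReal hx.ne (hf.ne_bot x)).symm⟩

lemma ProperConvexLsc.exists_coe (hf : ProperConvexLsc f) : ∃ (x : E) (a : ℝ), f x = a :=
  let ⟨x, hx⟩ := hf.dom_nonempty
  ⟨x, hf.exists_coe_of_lt_top hx⟩

lemma ProperConvexLsc.isClosed_epigraph (hf : ProperConvexLsc f) :
    IsClosed {p : E × ℝ | f p.1 ≤ (p.2 : EReal)} :=
  hf.lsc.isClosed_epigraph.preimage
    (continuous_fst.prodMk (continuous_coe_real_ereal.comp continuous_snd))

lemma inner_sub_le_conj (f : E → EReal) (u x : E) :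
    ((inner ℝ u x : ℝ) : EReal) - f x ≤ conj f u :=
  le_iSup (fun x => ((inner ℝ u x : ℝ) : EReal) - f x) x

lemma neg_conj_le_sub_inner (f : E → EReal) (u x : E) :
    -conj f u ≤ f x - ((inner ℝ u x : ℝ) : EReal) := by
  have h := EReal.neg_le_neg_iff.2 (inner_sub_le_conj f u x)
  rwa [EReal.neg_sub (.inl (EReal.coe_ne_bot _)) (.inl (EReal.coe_ne_top _)), add_comm,
    ← sub_eq_add_neg] at h

lemma conj_le_coe_iff {c : ℝ} :
    conj f u ≤ c ↔ ∀ (x : E) (a : ℝ), f x ≤ a → inner ℝ u x - a ≤ c := by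
  refine iSup_le_iff.trans (forall_congr' fun x => ⟨fun h a ha => ?_, fun h => ?_⟩)
  · exact_mod_cast (EReal.sub_le_sub le_rfl ha).trans h
  · induction hfx : f x with
    | bot => linarith [h (inner ℝ u x - c - 1) (by simp [hfx])]
    | coe a => exact_mod_cast h a hfx.le
    | top => simp

lemma mem_subdiff_iff :
    u ∈ subdiff f x ↔
      ∃ a : ℝ, f x = a ∧ ∀ (z : E) (b : ℝ), f z ≤ b → a + inner ℝ u (z - x) ≤ b := by
  constructor
  · rintro ⟨htop, hbot, h⟩
    lift f x to ℝ using ⟨htop, hbot⟩ with a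
    exact ⟨a, rfl, fun z b hb => by exact_mod_cast (h z).trans hb⟩
  · rintro ⟨a, ha, h⟩
    refine ⟨by simp [ha], by simp [ha], fun z => EReal.le_of_forall_lt_iff_le.1 fun b hb => ?_⟩
    rw [ha]
    exact_mod_cast h z b hb.le

lemma mem_subdiff_iff_conj_eq :
    u ∈ subdiff f x ↔ ∃ a : ℝ, f x = a ∧ conj f u = ((inner ℝ u x - a : ℝ) : EReal) := by
  rw [mem_subdiff_iff]
  refine exists_congr fun a => and_congr_right fun ha => ?_
  have hle : ((inner ℝ u x - a : ℝ) : EReal) ≤ conj f u := by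
    simpa only [ha, EReal.coe_sub] using inner_sub_le_conj f u x
  rw [← hle.ge_iff_eq', conj_le_coe_iff]
  refine forall₃_congr fun z b _ => ?_
  rw [inner_sub_right]
  constructor <;> intro h <;> linarith

lemma subdiff_monotone {z v : E} (hu : u ∈ subdiff f x) (hv : v ∈ subdiff f z) :
    0 ≤ inner ℝ (u - v) (x - z) := by
  obtain ⟨a, ha, hu⟩ := mem_subdiff_iff.1 hu
  obtain ⟨b, hb, hv⟩ := mem_subdiff_iff.1 hv
  have hxz := hu z b hb.le
  have hzx := hv x a ha.le
  simp only [inner_sub_left, inner_sub_right] at hxz hzx ⊢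
  linarith

lemma ProperConvexLsc.mem_subdiff_of_tendsto (hf : ProperConvexLsc f) {ι : Type*}
    {l : Filter ι} [l.NeBot] {ξ υ : ι → E} (hξ : Tendsto ξ l (𝓝 x)) (hυ : Tendsto υ l (𝓝 u))
    (h : ∀ i, υ i ∈ subdiff f (ξ i)) : u ∈ subdiff f x := by
  have hle : ∀ (z : E) (b : ℝ), f z ≤ b → f x ≤ ((b - inner ℝ u (z - x) : ℝ) : EReal) := by
    intro z b hb
    have hlim : Tendsto (fun i => (ξ i, b - inner ℝ (υ i) (z - ξ i))) l
        (𝓝 (x, b - inner ℝ u (z - x))) :=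
      hξ.prodMk_nhds (tendsto_const_nhds.sub (hυ.inner (tendsto_const_nhds.sub hξ)))
    refine hf.isClosed_epigraph.mem_of_tendsto hlim (Eventually.of_forall fun i => ?_)
    obtain ⟨a, ha, hsub⟩ := mem_subdiff_iff.1 (h i)
    rw [Set.mem_ofPred_eq, ha]
    exact_mod_cast le_sub_right_of_add_le (hsub z b hb)
  obtain ⟨z, b, hz⟩ := hf.exists_coe
  obtain ⟨a, ha⟩ := hf.exists_coe_of_lt_top ((hle z b hz.le).trans_lt (EReal.coe_lt_top _))
  refine mem_subdiff_iff.2 ⟨a, ha, fun z b hb => ?_⟩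
  have hab := hle z b hb
  rw [ha, EReal.coe_le_coe_iff] at hab
  linarith

lemma nonneg_of_forall_mul_add_sq_mul_nonneg {A B : ℝ}
    (h : ∀ t ∈ Set.Ioc (0 : ℝ) 1, 0 ≤ t * A + t ^ 2 * B) : 0 ≤ A := by
  have hlim : Tendsto (fun t : ℝ => A + t * B) (𝓝[>] 0) (𝓝 A) :=
    (Continuous.tendsto' (by fun_prop) 0 A (by simp)).mono_left nhdsWithin_le_nhds
  refine ge_of_tendsto hlim ?_
  filter_upwards [Ioc_mem_nhdsGT (zero_lt_one' ℝ)] with t ht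
  exact nonneg_of_mul_nonneg_right (by linarith [h t ht] : 0 ≤ t * (A + t * B)) ht.1

lemma IsProx.lt_top (hf : ProperConvexLsc f) {γ : ℝ} {p : E} (h : IsProx γ f x p) :
    f p < ⊤ := by
  obtain ⟨z, b, hz⟩ := hf.exists_coe
  by_contra htop
  have hle := h z
  rw [not_lt_top_iff.1 htop, hz, EReal.top_add_coe, top_le_iff, ← EReal.coe_add] at hle
  exact EReal.coe_ne_top _ hle

lemma IsProx.mem_subdiff (hf : ProperConvexLsc f) {γ : ℝ} {p : E} (h : IsProx γ f x p) :
    γ⁻¹ • (x - p) ∈ subdiff f p := by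
  obtain ⟨a, ha⟩ := hf.exists_coe_of_lt_top (h.lt_top hf)
  refine mem_subdiff_iff.2 ⟨a, ha, fun z b hb => ?_⟩
  suffices hvar : 0 ≤ (b - a) - γ⁻¹ * inner ℝ (x - p) (z - p) by
    rw [real_inner_smul_left]
    linarith
  -- Compare `p` with `p + t (z - p)` and let `t → 0`.
  refine nonneg_of_forall_mul_add_sq_mul_nonneg (B := ‖z - p‖ ^ 2 / (2 * γ)) fun t ht => ?_
  have hconv : f ((1 - t) • p + t • z) ≤ (((1 - t) * a + t * b : ℝ) : EReal) :=
    hf.convex_epigraph (x := (p, a)) ha.le (y := (z, b)) hb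
      (sub_nonneg.2 ht.2) ht.1.le (sub_add_cancel 1 t)
  have hmin := (h ((1 - t) • p + t • z)).trans (add_le_add_left hconv _)
  rw [ha, ← EReal.coe_add, ← EReal.coe_add, EReal.coe_le_coe_iff, norm_sub_rev p x,
    show (1 - t) • p + t • z - x = t • (z - p) - (x - p) by module, norm_sub_sq_real (t • _),
    real_inner_smul_left, real_inner_comm, norm_smul, mul_pow, Real.norm_eq_abs, sq_abs] at hmin
  have hexpand : (t ^ 2 * ‖z - p‖ ^ 2 - 2 * (t * inner ℝ (x - p) (z - p)) + ‖x - p‖ ^ 2) / (2 * γ)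
      = t ^ 2 * (‖z - p‖ ^ 2 / (2 * γ)) - t * (γ⁻¹ * inner ℝ (x - p) (z - p))
        + ‖x - p‖ ^ 2 / (2 * γ) := by
    ring
  linarith

lemma exists_conj_le_of_neg {w : E} {s m t : ℝ} (hs : s < 0)
    (hepi : ∀ (z : E) (b : ℝ), f z ≤ b → inner ℝ w z + s * b < m)
    (hm : m < inner ℝ w x + s * t) :
    ∃ (u : E) (c : ℝ), conj f u ≤ c ∧ t < inner ℝ u x - c := by
  have hs' : 0 < -s := neg_pos.2 hs
  refine ⟨(-s)⁻¹ • w, (-s)⁻¹ * m, conj_le_coe_iff.2 fun z b hb => ?_, ?_⟩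
  · rw [real_inner_smul_left, sub_le_iff_le_add, inv_mul_le_iff₀ hs', mul_add,
      mul_inv_cancel_left₀ hs'.ne']
    linarith [hepi z b hb]
  · rw [real_inner_smul_left, ← mul_sub, lt_inv_mul_iff₀ hs']
    linarith

end ConvexAnalysis

section FenchelMoreau

variable {E : Type*} [NormedAddCommGroup E] [InnerProductSpace ℝ E] [CompleteSpace E]
  {f : E → EReal} {x u : E}

lemma ProperConvexLsc.exists_separating (hf : ProperConvexLsc f) {t : ℝ} (ht : t < f x) :
    ∃ (w : E) (s m : ℝ), s ≤ 0 ∧ (∀ (z : E) (b : ℝ), f z ≤ b → inner ℝ w z + s * b < m) ∧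
      m < inner ℝ w x + s * t := by
  obtain ⟨φ, m, hφ, hm⟩ := geometric_hahn_banach_closed_point hf.convex_epigraph
    hf.isClosed_epigraph (x := (x, t)) ht.not_ge
  obtain ⟨w, s, hsplit⟩ := exists_forall_eq_inner_add_mul φ
  have hepi : ∀ (z : E) (b : ℝ), f z ≤ b → inner ℝ w z + s * b < m := fun z b hb =>
    hsplit z b ▸ hφ (z, b) hb
  refine ⟨w, s, m, ?_, hepi, hsplit x t ▸ hm⟩
  by_contra! hs
  obtain ⟨z, a, hz⟩ := hf.exists_coe
  let b := max a ((m - inner ℝ w z) / s)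
  have hsb : m - inner ℝ w z ≤ s * b := by
    rw [← div_le_iff₀' hs]
    exact le_max_right _ _
  linarith [hepi z b (hz.trans_le (by exact_mod_cast le_max_left _ _))]

lemma ProperConvexLsc.exists_conj_le (hf : ProperConvexLsc f) :
    ∃ (u : E) (c : ℝ), conj f u ≤ c := by
  obtain ⟨x, a, hx⟩ := hf.exists_coe
  have hlt : ((a - 1 : ℝ) : EReal) < f x := by
    rw [hx]
    exact_mod_cast sub_one_lt a
  obtain ⟨w, s, m, -, hepi, hm⟩ := hf.exists_separating hlt
  obtain ⟨u, c, hc, -⟩ := exists_conj_le_of_neg (by linarith [hepi x a hx.le]) hepi hm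
  exact ⟨u, c, hc⟩

lemma ProperConvexLsc.exists_conj_le_lt_inner_sub (hf : ProperConvexLsc f) {t : ℝ}
    (ht : t < f x) : ∃ (u : E) (c : ℝ), conj f u ≤ c ∧ t < inner ℝ u x - c := by
  obtain ⟨w, s, m, hs, hepi, hm⟩ := hf.exists_separating ht
  rcases hs.lt_or_eq with hs | rfl
  · exact exists_conj_le_of_neg hs hepi hm
  -- A vertical hyperplane: tilt some affine minorant by a large multiple of it.
  simp only [zero_mul, add_zero] at hepi hm
  obtain ⟨u, c, hc⟩ := hf.exists_conj_le
  obtain ⟨n, hn⟩ := exists_nat_gt ((t - (inner ℝ u x - c)) / (inner ℝ w x - m))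
  rw [div_lt_iff₀ (sub_pos.2 hm)] at hn
  refine ⟨u + (n : ℝ) • w, c + n * m, conj_le_coe_iff.2 fun z b hb => ?_, ?_⟩
  · have hu := conj_le_coe_iff.1 hc z b hb
    have hw := mul_le_mul_of_nonneg_left (hepi z b hb).le n.cast_nonneg
    rw [inner_add_left, real_inner_smul_left]
    linarith
  · rw [inner_add_left, real_inner_smul_left]
    linarith

theorem ProperConvexLsc.conj_conj (hf : ProperConvexLsc f) : conj (conj f) = f := by
  funext x
  refine le_antisymm (EReal.le_of_forall_lt_iff_le.1 fun a ha => ?_)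
    (EReal.ge_of_forall_gt_iff_ge.1 fun t ht => ?_)
  · refine conj_le_coe_iff.2 fun u c hc => ?_
    have := conj_le_coe_iff.1 hc x a ha.le
    rw [real_inner_comm]
    linarith
  · obtain ⟨u, c, hc, ht⟩ := hf.exists_conj_le_lt_inner_sub ht
    calc (t : EReal) ≤ ((inner ℝ x u : ℝ) : EReal) - c := by
          rw [real_inner_comm]
          exact_mod_cast ht.le
      _ ≤ ((inner ℝ x u : ℝ) : EReal) - conj f u := EReal.sub_le_sub le_rfl hc
      _ ≤ conj (conj f) x := inner_sub_le_conj _ _ _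

theorem ProperConvexLsc.conj (hf : ProperConvexLsc f) : ProperConvexLsc (conj f) where
  dom_nonempty := by
    obtain ⟨u, c, hc⟩ := hf.exists_conj_le
    exact ⟨u, hc.trans_lt (EReal.coe_lt_top c)⟩
  ne_bot u := by
    obtain ⟨x, a, hx⟩ := hf.exists_coe
    refine ne_bot_of_le_ne_bot ?_ (inner_sub_le_conj f u x)
    rw [hx, ← EReal.coe_sub]
    exact EReal.coe_ne_bot _
  convex_epigraph p hp q hq s t hs ht hst := by
    simp only [Set.mem_ofPred_eq, conj_le_coe_iff] at hp hq ⊢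
    intro x a ha
    calc inner ℝ (s • p + t • q).1 x - a
        = s * (inner ℝ p.1 x - a) + t * (inner ℝ q.1 x - a) := by
          simp only [Prod.fst_add, Prod.smul_fst, inner_add_left, real_inner_smul_left]
          linear_combination a * hst
      _ ≤ s * p.2 + t * q.2 := by gcongr; exacts [hp x a ha, hq x a ha]
  lsc := by
    refine lowerSemicontinuous_iSup fun x => Continuous.lowerSemicontinuous ?_
    induction f x with
    | bot => simpa using continuous_const
    | coe a =>
      simp only [← EReal.coe_sub]
      exact continuous_coe_real_ereal.comp (by fun_prop)
    | top => simpa using continuous_const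

theorem mem_subdiff_conj_iff (hf : ProperConvexLsc f) :
    x ∈ subdiff (conj f) u ↔ u ∈ subdiff f x := by
  rw [mem_subdiff_iff_conj_eq, mem_subdiff_iff_conj_eq, hf.conj_conj, real_inner_comm]
  constructor
  · rintro ⟨c, hc, hx⟩
    exact ⟨_, hx, by rw [hc, sub_sub_cancel]⟩
  · rintro ⟨a, hx, hu⟩
    exact ⟨_, hu, by rw [hx, sub_sub_cancel]⟩

end FenchelMoreau

section BoundedSublevel

variable {E : Type*} [NormedAddCommGroup E]

/-- The part of the sublevel set `{f ≤ n}` inside the ball of radius `n`. These sets exhaust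
`dom f` by bounded, closed and convex sets. -/
def boundedSublevel (f : E → EReal) (n : ℕ) : Set E :=
  Metric.closedBall 0 n ∩ {x | f x ≤ ((n : ℝ) : EReal)}

lemma boundedSublevel_mono (f : E → EReal) : Monotone (boundedSublevel f) := fun _ _ hmn =>
  Set.inter_subset_inter (Metric.closedBall_subset_closedBall (Nat.cast_le.2 hmn))
    fun _ hx => le_trans hx (EReal.coe_le_coe_iff.2 (Nat.cast_le.2 hmn))

lemma isBounded_boundedSublevel (f : E → EReal) (n : ℕ) :
    Bornology.IsBounded (boundedSublevel f n) :=
  Metric.isBounded_closedBall.subset Set.inter_subset_left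

variable [InnerProductSpace ℝ E] {f : E → EReal}

lemma ProperConvexLsc.convex_boundedSublevel (hf : ProperConvexLsc f) (n : ℕ) :
    Convex ℝ (boundedSublevel f n) := by
  refine (convex_closedBall _ _).inter fun x hx z hz s t hs ht hst => ?_
  have hmem := hf.convex_epigraph (x := (x, (n : ℝ))) hx (y := (z, (n : ℝ))) hz hs ht hst
  simpa [← add_mul, hst] using hmem

lemma ProperConvexLsc.isClosed_boundedSublevel (hf : ProperConvexLsc f) (n : ℕ) :
    IsClosed (boundedSublevel f n) :=
  Metric.isClosed_closedBall.inter (hf.lsc.isClosed_preimage _)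

lemma ProperConvexLsc.eventually_mem_boundedSublevel (hf : ProperConvexLsc f) {x : E}
    (hx : x ∈ effDom f) : ∀ᶠ n in atTop, x ∈ boundedSublevel f n := by
  obtain ⟨a, ha⟩ := hf.exists_coe_of_lt_top hx
  filter_upwards [tendsto_natCast_atTop_atTop.eventually_ge_atTop ‖x‖,
    tendsto_natCast_atTop_atTop.eventually_ge_atTop a] with n hxn han
  exact ⟨mem_closedBall_zero_iff.2 hxn, ha.trans_le (EReal.coe_le_coe_iff.2 han)⟩

end BoundedSublevel

section Qualification

variable {X Y : Type*} [NormedAddCommGroup X] [InnerProductSpace ℝ X] [NormedAddCommGroup Y]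
  [InnerProductSpace ℝ Y] {f : X → EReal} {g : Y → EReal} {K : X →L[ℝ] Y}

lemma zero_mem_sqri_of_mem_interior {C : Set Y} (h : (0 : Y) ∈ interior C) : (0 : Y) ∈ sqri C := by
  refine ⟨interior_subset h, ⊤, by simp, Set.eq_univ_of_forall fun v => ?_⟩
  have hlim : Tendsto (fun t : ℝ => t⁻¹ • v) atTop (𝓝 0) := by
    simpa using (tendsto_inv_atTop_zero (𝕜 := ℝ)).smul_const v
  have hmem : ∀ᶠ t : ℝ in atTop, t⁻¹ • v ∈ C := hlim (mem_interior_iff_mem_nhds.1 h)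
  obtain ⟨t, htC, ht⟩ := (hmem.and (eventually_gt_atTop 0)).exists
  refine Set.mem_iUnion₂.2 ⟨t, ht, t⁻¹ • v, ⟨_, htC, 0, rfl, sub_zero _⟩, ?_⟩
  exact smul_inv_smul₀ ht.ne' v

lemma exists_submodule_of_zero_mem_sqri {C : Set Y} (h : (0 : Y) ∈ sqri C) :
    ∃ V : Submodule ℝ Y, IsClosed (V : Set Y) ∧ C ⊆ V ∧
      ∀ v ∈ V, ∃ t : ℝ, 0 < t ∧ t • v ∈ C := by
  obtain ⟨-, V, hV, hcone⟩ := h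
  rw [Set.singleton_zero, sub_zero] at hcone
  refine ⟨V, hV, fun v hv => ?_, fun v hv => ?_⟩
  · rw [← hcone]
    exact Set.mem_iUnion₂.2 ⟨1, Set.mem_Ioi.2 one_pos, v, hv, one_smul ℝ v⟩
  · rw [← SetLike.mem_coe, ← hcone] at hv
    obtain ⟨t, ht, w, hw, rfl⟩ := Set.mem_iUnion₂.1 hv
    exact ⟨t⁻¹, inv_pos.2 ht, by rwa [inv_smul_smul₀ (ne_of_gt ht)]⟩

lemma QC1.qc2 (h : QC1 f g K) : QC2 f g K := by
  obtain ⟨x, ⟨hx, hKx⟩, hcont⟩ := h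
  have hdom : effDom g ∈ 𝓝 (K x) := hcont.eventually (Iio_mem_nhds hKx)
  have hshift : (fun v : Y => v + K x) ⁻¹' effDom g ∈ 𝓝 (0 : Y) :=
    (continuous_add_const (K x)).continuousAt.preimage_mem_nhds (by rwa [zero_add])
  exact mem_interior_iff_mem_nhds.2 (mem_of_superset hshift fun v hv =>
    ⟨v + K x, hv, K x, ⟨x, hx, rfl⟩, add_sub_cancel_right _ _⟩)

lemma QC2.qc3 (h : QC2 f g K) : QC3 f g K :=
  zero_mem_sqri_of_mem_interior h

lemma exists_boundedSublevel_sub_mem_nhds [CompleteSpace X] [CompleteSpace Y]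
    (hf : ProperConvexLsc f) (hg : ProperConvexLsc g) {V : Submodule ℝ Y}
    (hV : IsClosed (V : Set Y))
    (habs : ∀ v ∈ V, ∃ t : ℝ, 0 < t ∧ t • v ∈ effDom g - K '' effDom f) :
    ∃ n, ((↑) : V → Y) ⁻¹' (boundedSublevel g n - K '' boundedSublevel f n) ∈ 𝓝 0 := by
  have : CompleteSpace V := hV.completeSpace_coe
  refine exists_mem_nhds_zero_of_absorbing (fun m n hmn => ?_) (fun n => ?_) (fun n => ?_)
    fun v => ?_
  · exact Set.preimage_mono (Set.sub_subset_sub (boundedSublevel_mono g hmn)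
      (Set.image_mono (boundedSublevel_mono f hmn)))
  · exact ((hg.convex_boundedSublevel n).sub
      ((hf.convex_boundedSublevel n).linear_image K.toLinearMap)).linear_preimage V.subtype
  · exact (isClosed_sub_image K (hg.convex_boundedSublevel n) (hg.isClosed_boundedSublevel n)
      (isBounded_boundedSublevel g n) (hf.convex_boundedSublevel n)
      (hf.isClosed_boundedSublevel n) (isBounded_boundedSublevel f n)).preimage
        continuous_subtype_val
  · obtain ⟨t, ht, z, hz, _, ⟨x, hx, rfl⟩, hzx⟩ := habs v v.2
    obtain ⟨n, hzn, hxn⟩ := ((hg.eventually_mem_boundedSublevel hz).and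
      (hf.eventually_mem_boundedSublevel hx)).exists
    exact ⟨n, t, ht, z, hzn, _, ⟨x, hxn, rfl⟩, hzx⟩

end Qualification

section Multiplier

variable {X Y : Type*} [NormedAddCommGroup X] [InnerProductSpace ℝ X] [NormedAddCommGroup Y]
  [InnerProductSpace ℝ Y] {f : X → EReal} {g : Y → EReal} {K : X →L[ℝ] Y}

lemma exists_forall_add_inner_le [CompleteSpace Y] {Q : Set (Y × ℝ)} (hQ : Convex ℝ Q)
    {r₀ p : ℝ} (hr₀ : ((0 : Y), r₀) ∈ interior Q) (hp : ∀ r : ℝ, ((0 : Y), r) ∈ Q → p ≤ r) :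
    ∃ y : Y, ∀ q ∈ Q, p + inner ℝ y q.1 ≤ q.2 := by
  have hboundary : ((0 : Y), p) ∉ interior Q := by
    intro h
    have hnear : ∀ᶠ r in 𝓝[<] p, ((0 : Y), r) ∈ Q :=
      nhdsWithin_le_nhds ((Continuous.prodMk_right (0 : Y)).continuousAt
        (mem_interior_iff_mem_nhds.1 h))
    obtain ⟨r, hr, hrp⟩ := (hnear.and self_mem_nhdsWithin).exists
    exact (hp r hr).not_gt hrp
  obtain ⟨φ, hφ⟩ := geometric_hahn_banach_open_point hQ.interior isOpen_interior hboundary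
  have hle : ∀ q ∈ Q, φ q ≤ φ (0, p) := by
    intro q hq
    have hq' : q ∈ closure (interior Q) := by
      rw [hQ.closure_interior_eq_closure_of_nonempty_interior ⟨_, hr₀⟩]
      exact subset_closure hq
    exact closure_minimal (fun q hq => (hφ q hq).le)
      (isClosed_le φ.continuous continuous_const) hq'
  obtain ⟨w, s, hsplit⟩ := exists_forall_eq_inner_add_mul φ
  -- The hyperplane is not vertical, because `(0, r₀)` is an interior point of `Q`.
  have hs : 0 < -s := by
    have hlt := hφ _ hr₀
    rw [hsplit, hsplit, add_lt_add_iff_left] at hlt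
    have hpr : p ≤ r₀ := hp r₀ (interior_subset hr₀)
    nlinarith
  refine ⟨(-s)⁻¹ • w, fun ⟨v, r⟩ hq => ?_⟩
  have hvr := hle _ hq
  rw [hsplit, hsplit, inner_zero_right, zero_add] at hvr
  rw [real_inner_smul_left, ← le_sub_iff_add_le', inv_mul_le_iff₀ hs]
  linarith

/-- The set of pairs `(v, r)` such that `f x + g (K x + v) ≤ r` for some `x`. Up to the infimum
being attained, it is the epigraph of the value function `v ↦ inf_x (f x + g (K x + v))` of the
perturbed primal problem. -/
def perturbationEpi (f : X → EReal) (g : Y → EReal) (K : X →L[ℝ] Y) : Set (Y × ℝ) :=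
  {q | ∃ (x : X) (a : ℝ), f x ≤ a ∧ g (K x + q.1) ≤ ((q.2 - a : ℝ) : EReal)}

lemma sub_mem_perturbationEpi {x : X} {z : Y} {a b : ℝ} (ha : f x ≤ a) (hb : g z ≤ b) :
    (z - K x, a + b) ∈ perturbationEpi f g K :=
  ⟨x, a, ha, by simpa using hb⟩

lemma convex_perturbationEpi (hf : ProperConvexLsc f) (hg : ProperConvexLsc g) :
    Convex ℝ (perturbationEpi f g K) := by
  rintro ⟨v, r⟩ ⟨x, a, hx, hv⟩ ⟨v', r'⟩ ⟨x', a', hx', hv'⟩ s t hs ht hst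
  refine ⟨s • x + t • x', s * a + t * a',
    hf.convex_epigraph (x := (x, a)) hx (y := (x', a')) hx' hs ht hst, ?_⟩
  have hmem := hg.convex_epigraph (x := (K x + v, r - a)) hv (y := (K x' + v', r' - a')) hv'
    hs ht hst
  have hpoint : K (s • x + t • x') + (s • v + t • v') = s • (K x + v) + t • (K x' + v') := by
    rw [map_add, map_smul, map_smul]
    module
  have hvalue : s * r + t * r' - (s * a + t * a') = s * (r - a) + t * (r' - a') := by ring
  change g (K _ + (s • v + t • v')) ≤ ((s * r + t * r' - (s * a + t * a') : ℝ) : EReal)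
  rw [hpoint, hvalue]
  exact hmem

lemma exists_forall_mem_perturbationEpi [CompleteSpace X] [CompleteSpace Y]
    (hf : ProperConvexLsc f) (hg : ProperConvexLsc g) (hQC : QC3 f g K) {p : ℝ}
    (hp : ∀ r : ℝ, (0, r) ∈ perturbationEpi f g K → p ≤ r) :
    ∃ y : Y, ∀ q ∈ perturbationEpi f g K, p + inner ℝ y q.1 ≤ q.2 := by
  obtain ⟨V, hV, hsub, habs⟩ := exists_submodule_of_zero_mem_sqri hQC
  have : CompleteSpace V := hV.completeSpace_coe
  obtain ⟨n, hn⟩ := exists_boundedSublevel_sub_mem_nhds hf hg hV habs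
  -- `perturbationEpi f g K` lives in `V × ℝ`, where it has interior points.
  let Q : Set (V × ℝ) := V.subtype.prodMap LinearMap.id ⁻¹' perturbationEpi f g K
  have hinterior : ((0 : V), (n + n + 1 : ℝ)) ∈ interior Q := by
    refine mem_interior_iff_mem_nhds.2
      (mem_of_superset (prod_mem_nhds hn (Ioi_mem_nhds (lt_add_one (n + n : ℝ)))) ?_)
    rintro ⟨v, r⟩ ⟨⟨z, hz, _, ⟨x, hx, rfl⟩, hzx⟩, hr⟩
    refine ⟨x, n, hx.2, ?_⟩
    have hr : (n : ℝ) ≤ r - n := (lt_sub_iff_add_lt.2 hr).le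
    have hzx : K x + (v : Y) = z := hzx ▸ add_sub_cancel (K x) z
    exact (congrArg g hzx).trans_le (hz.2.trans (EReal.coe_le_coe_iff.2 hr))
  obtain ⟨y, hy⟩ := exists_forall_add_inner_le
    ((convex_perturbationEpi hf hg).linear_preimage _) hinterior hp
  refine ⟨y, fun ⟨v, r⟩ hq => ?_⟩
  obtain ⟨x, a, hx, hv⟩ := hq
  have hvV : v ∈ V := hsub ⟨K x + v, hv.trans_lt (EReal.coe_lt_top _), K x,
    ⟨x, hx.trans_lt (EReal.coe_lt_top _), rfl⟩, add_sub_cancel_left _ _⟩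
  exact hy (⟨v, hvV⟩, r) ⟨x, a, hx, hv⟩

end Multiplier

section Saddle

variable {X Y : Type*} [NormedAddCommGroup X] [InnerProductSpace ℝ X] [CompleteSpace X]
  [NormedAddCommGroup Y] [InnerProductSpace ℝ Y] [CompleteSpace Y]
  {f : X → EReal} {g : Y → EReal} {K : X →L[ℝ] Y} {x : X} {y y' : Y}

lemma exists_coe_of_add_eq_coe {a b : EReal} {r : ℝ} (h : a + b = r) :
    ∃ a' b' : ℝ, a = a' ∧ b = b' ∧ a' + b' = r := by
  induction a <;> induction b <;> simp_all [← EReal.coe_add]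

lemma inner_neg_adjoint (K : X →L[ℝ] Y) (x : X) (y : Y) :
    inner ℝ (-(ContinuousLinearMap.adjoint K y)) x = -inner ℝ y (K x) := by
  rw [inner_neg_left, ContinuousLinearMap.adjoint_inner_left]

lemma dualObj_le_primalObj (f : X → EReal) (g : Y → EReal) (K : X →L[ℝ] Y) (x : X) (y : Y) :
    dualObj f g K y ≤ primalObj f g K x := by
  have hf := neg_conj_le_sub_inner f (-(ContinuousLinearMap.adjoint K y)) x
  have hg := neg_conj_le_sub_inner g y (K x)
  rw [inner_neg_adjoint] at hf
  refine (add_le_add hf hg).trans_eq ?_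
  rw [sub_eq_add_neg, sub_eq_add_neg, add_add_add_comm, ← EReal.coe_neg, ← EReal.coe_neg,
    neg_neg, ← EReal.coe_add, add_neg_cancel, EReal.coe_zero, add_zero, primalObj]

/-- The optimality conditions of the primal-dual pair; equivalently, `(x, y)` is a saddle point
of the Lagrangian `f x + ⟪K x, y⟫ - g* y`. -/
def IsSaddlePoint (f : X → EReal) (g : Y → EReal) (K : X →L[ℝ] Y) (x : X) (y : Y) : Prop :=
  -(ContinuousLinearMap.adjoint K y) ∈ subdiff f x ∧ K x ∈ subdiff (conj g) y

lemma isSaddlePoint_iff (hg : ProperConvexLsc g) :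
    IsSaddlePoint f g K x y ↔ ∃ r : ℝ, primalObj f g K x = r ∧ dualObj f g K y = r := by
  rw [IsSaddlePoint, mem_subdiff_conj_iff hg, mem_subdiff_iff_conj_eq, mem_subdiff_iff_conj_eq,
    inner_neg_adjoint]
  constructor
  · rintro ⟨⟨a, ha, ha'⟩, b, hb, hb'⟩
    refine ⟨a + b, by rw [primalObj, ha, hb, EReal.coe_add], ?_⟩
    rw [dualObj, ha', hb', ← EReal.coe_neg, ← EReal.coe_sub, EReal.coe_eq_coe_iff]
    ring
  · rintro ⟨r, hp, hd⟩
    obtain ⟨a, b, ha, hb, hab⟩ := exists_coe_of_add_eq_coe hp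
    rw [dualObj, sub_eq_add_neg] at hd
    obtain ⟨c, d, hc, hd, hcd⟩ := exists_coe_of_add_eq_coe hd
    have hfc := neg_conj_le_sub_inner f (-(ContinuousLinearMap.adjoint K y)) x
    have hgd := neg_conj_le_sub_inner g y (K x)
    rw [hc, ha, inner_neg_adjoint, ← EReal.coe_sub, EReal.coe_le_coe_iff] at hfc
    rw [hd, hb, ← EReal.coe_sub, EReal.coe_le_coe_iff] at hgd
    refine ⟨⟨a, ha, ?_⟩, b, hb, ?_⟩
    · rw [← neg_neg (conj f _), hc, ← EReal.coe_neg, EReal.coe_eq_coe_iff]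
      linarith
    · rw [← neg_neg (conj g _), hd, ← EReal.coe_neg, EReal.coe_eq_coe_iff]
      linarith

lemma IsSaddlePoint.primalObj_eq_dualObj (hg : ProperConvexLsc g) (h : IsSaddlePoint f g K x y) :
    primalObj f g K x = dualObj f g K y := by
  obtain ⟨r, hp, hd⟩ := (isSaddlePoint_iff hg).1 h
  exact hp.trans hd.symm

lemma IsSaddlePoint.isPrimalOptimal (hg : ProperConvexLsc g) (h : IsSaddlePoint f g K x y) :
    IsPrimalOptimal f g K x := fun z =>
  (h.primalObj_eq_dualObj hg).trans_le (dualObj_le_primalObj f g K z y)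

lemma IsSaddlePoint.isDualOptimal (hg : ProperConvexLsc g) (h : IsSaddlePoint f g K x y) :
    IsDualOptimal f g K y := fun z =>
  (dualObj_le_primalObj f g K x z).trans_eq (h.primalObj_eq_dualObj hg)

lemma IsSaddlePoint.iInf_eq_iSup (hg : ProperConvexLsc g) (h : IsSaddlePoint f g K x y) :
    (⨅ x, primalObj f g K x) = ⨆ y, dualObj f g K y := by
  refine le_antisymm ?_ (iSup_le fun z => le_iInf fun w => dualObj_le_primalObj f g K w z)
  exact iInf_le_of_le x ((h.primalObj_eq_dualObj hg).trans_le (le_iSup (dualObj f g K) y))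

lemma IsSaddlePoint.of_isDualOptimal (hg : ProperConvexLsc g) (h : IsSaddlePoint f g K x y)
    (hy' : IsDualOptimal f g K y') : IsSaddlePoint f g K x y' := by
  obtain ⟨r, hp, hd⟩ := (isSaddlePoint_iff hg).1 h
  exact (isSaddlePoint_iff hg).2 ⟨r, hp, ((h.isDualOptimal hg y').antisymm (hy' y)).trans hd⟩

lemma exists_isSaddlePoint (hf : ProperConvexLsc f) (hg : ProperConvexLsc g) (hQC : QC3 f g K)
    (hx : IsPrimalOptimal f g K x) : ∃ y, IsSaddlePoint f g K x y := by
  obtain ⟨z, hz, _, ⟨w, hw, rfl⟩, hzw⟩ := hQC.1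
  obtain rfl : z = K w := sub_eq_zero.1 hzw
  have hfin : f x + g (K x) ≠ ⊤ := ((hx w).trans_lt (EReal.add_lt_top hw.ne hz.ne)).ne
  rw [EReal.add_ne_top_iff_ne_top₂ (hf.ne_bot _) (hg.ne_bot _)] at hfin
  obtain ⟨a, ha⟩ := hf.exists_coe_of_lt_top (lt_top_iff_ne_top.2 hfin.1)
  obtain ⟨b, hb⟩ := hg.exists_coe_of_lt_top (lt_top_iff_ne_top.2 hfin.2)
  obtain ⟨y, hy⟩ := exists_forall_mem_perturbationEpi hf hg hQC (p := a + b) (by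
    rintro r ⟨u, c, hc, hr⟩
    have hle := (hx u).trans (add_le_add hc (by simpa using hr))
    rw [primalObj, ha, hb] at hle
    have hle' : a + b ≤ c + (r - c) := by exact_mod_cast hle
    linarith)
  refine ⟨y, mem_subdiff_iff.2 ⟨a, ha, fun u c hc => ?_⟩,
    (mem_subdiff_conj_iff hg).2 (mem_subdiff_iff.2 ⟨b, hb, fun v d hd => ?_⟩)⟩
  · have hyu := hy _ (sub_mem_perturbationEpi hc hb.le)
    rw [inner_neg_adjoint, map_sub, ← inner_neg_right, neg_sub]
    linarith
  · have hyv := hy _ (sub_mem_perturbationEpi ha.le hd)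
    linarith

end Saddle

section Energy

variable {E : Type*} [NormedAddCommGroup E] {z : ℕ → E} {z₀ : E}

lemma isBounded_range_of_norm_sub_sq_le {c : ℝ} (h : ∀ n, ‖z n - z₀‖ ^ 2 ≤ c) :
    Bornology.IsBounded (Set.range z) :=
  Metric.isBounded_closedBall.subset (Set.range_subset_iff.2 fun n =>
    mem_closedBall_iff_norm.2 (Real.le_sqrt_of_sq_le (h n)))

lemma tendsto_of_norm_sub_sq_le {c : ℝ} {e : ℕ → ℝ} (he : Tendsto e atTop (𝓝 0))
    (h : ∀ n, ‖z n - z₀‖ ^ 2 ≤ c * e n) : Tendsto z atTop (𝓝 z₀) := by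
  rw [tendsto_iff_norm_sub_tendsto_zero]
  have hsq : Tendsto (fun n => ‖z n - z₀‖ ^ 2) atTop (𝓝 0) :=
    squeeze_zero (fun n => sq_nonneg _) h (by simpa using he.const_mul c)
  simpa using hsq.sqrt

lemma tendsto_sub_succ_of_antitone {e : ℕ → ℝ} (he : Antitone e) (hnonneg : ∀ n, 0 ≤ e n) :
    Tendsto (fun n => e n - e (n + 1)) atTop (𝓝 0) := by
  have hlim := tendsto_atTop_ciInf he ⟨0, Set.forall_mem_range.2 hnonneg⟩
  simpa using hlim.sub ((tendsto_add_atTop_iff_nat 1).2 hlim)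

lemma inner_sub_sub_eq_norm_sq [InnerProductSpace ℝ E] (a b c : E) :
    inner ℝ (a - b) (b - c) = (‖a - c‖ ^ 2 - ‖b - c‖ ^ 2 - ‖b - a‖ ^ 2) / 2 := by
  rw [← sub_add_sub_cancel a b c, norm_add_sq_real, norm_sub_rev b a]
  ring

variable {X Y : Type*} [NormedAddCommGroup X] [InnerProductSpace ℝ X] [NormedAddCommGroup Y]
  [InnerProductSpace ℝ Y] {K : X →L[ℝ] Y} {σ τ : ℝ}

lemma abs_inner_apply_le (K : X →L[ℝ] Y) (u : X) (w : Y) :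
    |inner ℝ (K u) w| ≤ ‖K‖ * ‖u‖ * ‖w‖ :=
  (abs_real_inner_le_norm _ _).trans
    (mul_le_mul_of_nonneg_right (K.le_opNorm u) (norm_nonneg w))

lemma inner_apply_le_sqrt_mul (K : X →L[ℝ] Y) (hσ : 0 < σ) (hτ : 0 < τ) (u : X) (w : Y) :
    inner ℝ (K u) w ≤ √(σ * τ) * ‖K‖ * (‖u‖ ^ 2 / (2 * τ) + ‖w‖ ^ 2 / (2 * σ)) := by
  have hmul : ‖u‖ * ‖w‖ ≤ √(σ * τ) * (‖u‖ ^ 2 / (2 * τ) + ‖w‖ ^ 2 / (2 * σ)) := by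
    obtain ⟨p, hp, rfl⟩ : ∃ p, 0 < p ∧ p ^ 2 = σ := ⟨√σ, Real.sqrt_pos.2 hσ, Real.sq_sqrt hσ.le⟩
    obtain ⟨q, hq, rfl⟩ : ∃ q, 0 < q ∧ q ^ 2 = τ := ⟨√τ, Real.sqrt_pos.2 hτ, Real.sq_sqrt hτ.le⟩
    have hsquare : p * q * (‖u‖ ^ 2 / (2 * q ^ 2) + ‖w‖ ^ 2 / (2 * p ^ 2)) - ‖u‖ * ‖w‖
        = (p * ‖u‖ - q * ‖w‖) ^ 2 / (2 * p * q) := by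
      field_simp
      ring
    rw [← mul_pow, Real.sqrt_sq (by positivity), ← sub_nonneg, hsquare]
    positivity
  calc inner ℝ (K u) w ≤ ‖K‖ * ‖u‖ * ‖w‖ := (le_abs_self _).trans (abs_inner_apply_le K u w)
    _ ≤ ‖K‖ * (√(σ * τ) * (‖u‖ ^ 2 / (2 * τ) + ‖w‖ ^ 2 / (2 * σ))) := by
      rw [mul_assoc]
      gcongr
    _ = _ := by ring

lemma neg_inner_apply_le (K : X →L[ℝ] Y) (hσ : σ ≠ 0) (hτ : 0 < τ) (u : X) (w : Y) :
    -inner ℝ (K u) w ≤ ‖u‖ ^ 2 / (2 * τ) + σ * τ * ‖K‖ ^ 2 * (‖w‖ ^ 2 / (2 * σ)) := by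
  refine ((neg_le_abs _).trans (abs_inner_apply_le K u w)).trans ?_
  have hsquare : ‖u‖ ^ 2 / (2 * τ) + σ * τ * ‖K‖ ^ 2 * (‖w‖ ^ 2 / (2 * σ)) - ‖K‖ * ‖u‖ * ‖w‖
      = (‖u‖ - τ * ‖K‖ * ‖w‖) ^ 2 / (2 * τ) := by
    field_simp
    ring
  rw [← sub_nonneg, hsquare]
  positivity

lemma sqrt_mul_opNorm_lt_one (hK : σ * τ * ‖K‖ ^ 2 < 1) : √(σ * τ) * ‖K‖ < 1 := by
  rw [← Real.sqrt_sq (norm_nonneg K), ← Real.sqrt_mul' _ (sq_nonneg _)]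
  exact (Real.sqrt_lt_sqrt_iff_of_pos one_pos).2 hK |>.trans_eq Real.sqrt_one

/-- The Lyapunov function of the primal-dual algorithm relative to a saddle point `(x₀, y₀)`. The
argument `u` is the extrapolation step `x̄ⁿ - xⁿ`. -/
noncomputable def energy (K : X →L[ℝ] Y) (σ τ : ℝ) (x₀ : X) (y₀ : Y) (u x : X) (y : Y) : ℝ :=
  ‖x - x₀‖ ^ 2 / (2 * τ) + ‖y - y₀‖ ^ 2 / (2 * σ) + inner ℝ (K u) (y - y₀) + ‖u‖ ^ 2 / (2 * τ)

lemma le_energy (hσ : σ ≠ 0) (hτ : 0 < τ) (x₀ : X) (y₀ : Y) (u x : X) (y : Y) :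
    ‖x - x₀‖ ^ 2 / (2 * τ) + (1 - σ * τ * ‖K‖ ^ 2) * (‖y - y₀‖ ^ 2 / (2 * σ))
      ≤ energy K σ τ x₀ y₀ u x y := by
  have hinner := neg_inner_apply_le K hσ hτ u (y - y₀)
  rw [energy]
  linarith

lemma norm_fst_sub_sq_le_energy (hσ : 0 < σ) (hτ : 0 < τ) (hK : σ * τ * ‖K‖ ^ 2 < 1)
    (x₀ : X) (y₀ : Y) (u x : X) (y : Y) :
    ‖x - x₀‖ ^ 2 ≤ 2 * τ * energy K σ τ x₀ y₀ u x y := by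
  have hk : 0 < 1 - σ * τ * ‖K‖ ^ 2 := sub_pos.2 hK
  rw [← div_le_iff₀' (by positivity)]
  exact le_of_add_le_of_nonneg_left (le_energy hσ.ne' hτ x₀ y₀ u x y)
    (mul_nonneg hk.le (by positivity))

lemma norm_snd_sub_sq_le_energy (hσ : 0 < σ) (hτ : 0 < τ) (hK : σ * τ * ‖K‖ ^ 2 < 1)
    (x₀ : X) (y₀ : Y) (u x : X) (y : Y) :
    ‖y - y₀‖ ^ 2 ≤ 2 * σ * (1 - σ * τ * ‖K‖ ^ 2)⁻¹ * energy K σ τ x₀ y₀ u x y := by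
  have hk : 0 < 1 - σ * τ * ‖K‖ ^ 2 := sub_pos.2 hK
  rw [mul_assoc, ← div_le_iff₀' (by positivity), le_inv_mul_iff₀ hk]
  exact le_of_add_le_of_nonneg_right (le_energy hσ.ne' hτ x₀ y₀ u x y) (by positivity)

lemma energy_nonneg (hσ : 0 < σ) (hτ : 0 < τ) (hK : σ * τ * ‖K‖ ^ 2 < 1)
    (x₀ : X) (y₀ : Y) (u x : X) (y : Y) : 0 ≤ energy K σ τ x₀ y₀ u x y :=
  nonneg_of_mul_nonneg_right
    ((sq_nonneg _).trans (norm_fst_sub_sq_le_energy hσ hτ hK x₀ y₀ u x y)) (by positivity)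

lemma energy_add_le {x₀ x x' u : X} {y₀ y y' : Y}
    (hx : inner ℝ (K (x' - x₀)) (y' - y₀) ≤ τ⁻¹ * inner ℝ (x - x') (x' - x₀))
    (hy : -inner ℝ (K (x + u - x₀)) (y' - y₀) ≤ σ⁻¹ * inner ℝ (y - y') (y' - y₀)) :
    energy K σ τ x₀ y₀ (x' - x) x' y'
        + (‖u‖ ^ 2 / (2 * τ) + ‖y' - y‖ ^ 2 / (2 * σ) - inner ℝ (K u) (y' - y))
      ≤ energy K σ τ x₀ y₀ u x y := by
  -- The extrapolation `x + u` makes the cross terms telescope up to `⟪K u, y' - y⟫`.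
  have hcross : inner ℝ (K (x + u - x₀)) (y' - y₀) - inner ℝ (K (x' - x₀)) (y' - y₀)
      = inner ℝ (K u) (y - y₀) + inner ℝ (K u) (y' - y) - inner ℝ (K (x' - x)) (y' - y₀) := by
    simp only [map_add, map_sub, inner_add_left, inner_sub_left, inner_sub_right]
    ring
  have hhalf : ∀ a b c d : ℝ, a⁻¹ * ((b - c - d) / 2) = b / (2 * a) - c / (2 * a) - d / (2 * a) :=
    fun a b c d => by ring
  rw [inner_sub_sub_eq_norm_sq, hhalf] at hx hy
  rw [energy, energy]
  linarith

end Energy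

namespace IsPrimalDualSeq

variable {X Y : Type*} [NormedAddCommGroup X] [InnerProductSpace ℝ X] [CompleteSpace X]
  [NormedAddCommGroup Y] [InnerProductSpace ℝ Y] [CompleteSpace Y]
  {f : X → EReal} {g : Y → EReal} {K : X →L[ℝ] Y} {σ τ : ℝ} {x xbar : ℕ → X} {y : ℕ → Y}
  {x₀ : X} {y₀ : Y}

lemma mem_subdiff (h : IsPrimalDualSeq f g K σ τ x xbar y) (hf : ProperConvexLsc f) (hτ : τ ≠ 0)
    (n : ℕ) : τ⁻¹ • (x n - x (n + 1)) - ContinuousLinearMap.adjoint K (y (n + 1))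
      ∈ subdiff f (x (n + 1)) := by
  have hprox := (h.step_x n).mem_subdiff hf
  rwa [sub_right_comm, smul_sub _ (_ - _), inv_smul_smul₀ hτ] at hprox

lemma mem_subdiff_conj (h : IsPrimalDualSeq f g K σ τ x xbar y) (hg : ProperConvexLsc g)
    (hσ : σ ≠ 0) (n : ℕ) :
    σ⁻¹ • (y n - y (n + 1)) + K (xbar n) ∈ subdiff (conj g) (y (n + 1)) := by
  have hprox := (h.step_y n).mem_subdiff hg.conj
  rwa [add_sub_right_comm, smul_add, inv_smul_smul₀ hσ] at hprox

lemma xbar_sub (h : IsPrimalDualSeq f g K σ τ x xbar y) (n : ℕ) :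
    xbar (n + 1) - x (n + 1) = x (n + 1) - x n := by
  rw [h.step_xbar]
  module

lemma energy_succ_add_le (h : IsPrimalDualSeq f g K σ τ x xbar y) (hf : ProperConvexLsc f)
    (hg : ProperConvexLsc g) (hσ : 0 < σ) (hτ : 0 < τ) (h₀ : IsSaddlePoint f g K x₀ y₀) (n : ℕ) :
    energy K σ τ x₀ y₀ (xbar (n + 1) - x (n + 1)) (x (n + 1)) (y (n + 1))
        + (1 - √(σ * τ) * ‖K‖) *
          (‖xbar n - x n‖ ^ 2 / (2 * τ) + ‖y (n + 1) - y n‖ ^ 2 / (2 * σ))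
      ≤ energy K σ τ x₀ y₀ (xbar n - x n) (x n) (y n) := by
  have hx := subdiff_monotone (h.mem_subdiff hf hτ.ne' n) h₀.1
  have hy := subdiff_monotone (h.mem_subdiff_conj hg hσ.ne' n) h₀.2
  rw [sub_neg_eq_add, sub_add, ← map_sub, inner_sub_left, ContinuousLinearMap.adjoint_inner_left,
    real_inner_smul_left, sub_nonneg, real_inner_comm] at hx
  rw [add_sub_assoc, ← map_sub, inner_add_left, real_inner_smul_left, ← neg_le_iff_add_nonneg]
    at hy
  rw [← add_sub_cancel (x n) (xbar n)] at hy
  have hstep := energy_add_le hx hy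
  have hyoung := inner_apply_le_sqrt_mul K hσ hτ (xbar n - x n) (y (n + 1) - y n)
  rw [h.xbar_sub]
  linarith

lemma antitone_energy (h : IsPrimalDualSeq f g K σ τ x xbar y) (hf : ProperConvexLsc f)
    (hg : ProperConvexLsc g) (hσ : 0 < σ) (hτ : 0 < τ) (hK : σ * τ * ‖K‖ ^ 2 < 1)
    (h₀ : IsSaddlePoint f g K x₀ y₀) :
    Antitone fun n => energy K σ τ x₀ y₀ (xbar n - x n) (x n) (y n) := by
  have hk := sub_pos.2 (sqrt_mul_opNorm_lt_one hK)
  refine antitone_nat_of_succ_le fun n => ?_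
  exact le_of_add_le_of_nonneg_left (h.energy_succ_add_le hf hg hσ hτ h₀ n)
    (mul_nonneg hk.le (by positivity))

lemma norm_sq_le (h : IsPrimalDualSeq f g K σ τ x xbar y) (hf : ProperConvexLsc f)
    (hg : ProperConvexLsc g) (hσ : 0 < σ) (hτ : 0 < τ) (hK : σ * τ * ‖K‖ ^ 2 < 1)
    (h₀ : IsSaddlePoint f g K x₀ y₀) (n : ℕ) :
    ‖x n - x₀‖ ^ 2 / (2 * τ) + (1 - σ * τ * ‖K‖ ^ 2) * (‖y n - y₀‖ ^ 2 / (2 * σ)) ≤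
      ‖x 0 - x₀‖ ^ 2 / (2 * τ) + ‖y 0 - y₀‖ ^ 2 / (2 * σ) := by
  have hinit : energy K σ τ x₀ y₀ (xbar 0 - x 0) (x 0) (y 0)
      = ‖x 0 - x₀‖ ^ 2 / (2 * τ) + ‖y 0 - y₀‖ ^ 2 / (2 * σ) := by
    simp [energy, h.init]
  rw [← hinit]
  exact (le_energy hσ.ne' hτ x₀ y₀ _ _ _).trans (h.antitone_energy hf hg hσ hτ hK h₀ n.zero_le)

lemma isBounded_range (h : IsPrimalDualSeq f g K σ τ x xbar y) (hf : ProperConvexLsc f)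
    (hg : ProperConvexLsc g) (hσ : 0 < σ) (hτ : 0 < τ) (hK : σ * τ * ‖K‖ ^ 2 < 1)
    (h₀ : IsSaddlePoint f g K x₀ y₀) : Bornology.IsBounded (Set.range fun n => (x n, y n)) := by
  have henergy n := h.antitone_energy hf hg hσ hτ hK h₀ (Nat.zero_le n)
  have hx : Bornology.IsBounded (Set.range x) := isBounded_range_of_norm_sub_sq_le fun n =>
    (norm_fst_sub_sq_le_energy hσ hτ hK x₀ y₀ _ _ _).trans
      (mul_le_mul_of_nonneg_left (henergy n) (by positivity))
  have hy : Bornology.IsBounded (Set.range y) := isBounded_range_of_norm_sub_sq_le fun n =>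
    (norm_snd_sub_sq_le_energy hσ hτ hK x₀ y₀ _ _ _).trans
      (mul_le_mul_of_nonneg_left (henergy n)
        (mul_nonneg (by positivity) (inv_nonneg.2 (sub_pos.2 hK).le)))
  exact (hx.prod hy).subset
    (Set.range_subset_iff.2 fun n => ⟨Set.mem_range_self n, Set.mem_range_self n⟩)

lemma tendsto_increments (h : IsPrimalDualSeq f g K σ τ x xbar y) (hf : ProperConvexLsc f)
    (hg : ProperConvexLsc g) (hσ : 0 < σ) (hτ : 0 < τ) (hK : σ * τ * ‖K‖ ^ 2 < 1)
    (h₀ : IsSaddlePoint f g K x₀ y₀) :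
    Tendsto (fun n => xbar n - x n) atTop (𝓝 0) ∧
      Tendsto (fun n => y (n + 1) - y n) atTop (𝓝 0) := by
  let e : ℕ → ℝ := fun n => energy K σ τ x₀ y₀ (xbar n - x n) (x n) (y n)
  have hdiff : Tendsto (fun n => e n - e (n + 1)) atTop (𝓝 0) :=
    tendsto_sub_succ_of_antitone (h.antitone_energy hf hg hσ hτ hK h₀)
      fun n => energy_nonneg hσ hτ hK x₀ y₀ _ _ _
  have hk := sub_pos.2 (sqrt_mul_opNorm_lt_one hK)
  have hbound n : ‖xbar n - x n‖ ^ 2 / (2 * τ) + ‖y (n + 1) - y n‖ ^ 2 / (2 * σ)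
      ≤ (1 - √(σ * τ) * ‖K‖)⁻¹ * (e n - e (n + 1)) := by
    rw [le_inv_mul_iff₀ hk, le_sub_iff_add_le']
    exact h.energy_succ_add_le hf hg hσ hτ h₀ n
  constructor
  · refine tendsto_of_norm_sub_sq_le (c := 2 * τ * (1 - √(σ * τ) * ‖K‖)⁻¹) hdiff fun n => ?_
    rw [sub_zero, mul_assoc, ← div_le_iff₀' (by positivity)]
    exact le_of_add_le_of_nonneg_left (hbound n) (by positivity)
  · refine tendsto_of_norm_sub_sq_le (c := 2 * σ * (1 - √(σ * τ) * ‖K‖)⁻¹) hdiff fun n => ?_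
    rw [sub_zero, mul_assoc, ← div_le_iff₀' (by positivity)]
    exact le_of_add_le_of_nonneg_right (hbound n) (by positivity)

lemma isSaddlePoint_of_tendsto_subseq (h : IsPrimalDualSeq f g K σ τ x xbar y)
    (hf : ProperConvexLsc f) (hg : ProperConvexLsc g) (hσ : σ ≠ 0) (hτ : τ ≠ 0)
    (hu : Tendsto (fun n => xbar n - x n) atTop (𝓝 0))
    (hw : Tendsto (fun n => y (n + 1) - y n) atTop (𝓝 0)) {φ : ℕ → ℕ}
    (hφ : Tendsto φ atTop atTop) (hx : Tendsto (x ∘ φ) atTop (𝓝 x₀))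
    (hy : Tendsto (y ∘ φ) atTop (𝓝 y₀)) : IsSaddlePoint f g K x₀ y₀ := by
  have hxbar : Tendsto (xbar ∘ φ) atTop (𝓝 x₀) := by
    simpa [Function.comp_def] using (hu.comp hφ).add hx
  have hx_succ : Tendsto (fun k => x (φ k + 1)) atTop (𝓝 x₀) := by
    have hsub := ((tendsto_add_atTop_iff_nat 1).2 hu).comp hφ
    simpa [h.xbar_sub, Function.comp_def] using hsub.add hx
  have hy_succ : Tendsto (fun k => y (φ k + 1)) atTop (𝓝 y₀) := by
    simpa using (hw.comp hφ).add hy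
  constructor
  · have hlim := ((hx.sub hx_succ).const_smul τ⁻¹).sub
      (((ContinuousLinearMap.adjoint K).continuous.tendsto y₀).comp hy_succ)
    rw [sub_self, smul_zero, zero_sub] at hlim
    exact hf.mem_subdiff_of_tendsto hx_succ hlim fun k => h.mem_subdiff hf hτ (φ k)
  · have hlim := ((hy.sub hy_succ).const_smul σ⁻¹).add ((K.continuous.tendsto x₀).comp hxbar)
    rw [sub_self, smul_zero, zero_add] at hlim
    exact hg.conj.mem_subdiff_of_tendsto hy_succ hlim
      fun k => h.mem_subdiff_conj hg hσ (φ k)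

lemma tendsto_of_tendsto_subseq (h : IsPrimalDualSeq f g K σ τ x xbar y)
    (hf : ProperConvexLsc f) (hg : ProperConvexLsc g) (hσ : 0 < σ) (hτ : 0 < τ)
    (hK : σ * τ * ‖K‖ ^ 2 < 1) (h₀ : IsSaddlePoint f g K x₀ y₀)
    {φ : ℕ → ℕ} (hφ : Tendsto φ atTop atTop) (hx : Tendsto (x ∘ φ) atTop (𝓝 x₀))
    (hy : Tendsto (y ∘ φ) atTop (𝓝 y₀)) : Tendsto x atTop (𝓝 x₀) ∧ Tendsto y atTop (𝓝 y₀) := by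
  have hu := (h.tendsto_increments hf hg hσ hτ hK h₀).1
  have hcont : Continuous fun q : X × X × Y => energy K σ τ x₀ y₀ q.1 q.2.1 q.2.2 := by
    unfold energy
    fun_prop
  have hsub := (hcont.tendsto (0, x₀, y₀)).comp
    ((hu.comp hφ).prodMk_nhds (hx.prodMk_nhds hy))
  have hzero : energy K σ τ x₀ y₀ 0 x₀ y₀ = 0 := by simp [energy]
  rw [hzero] at hsub
  have henergy :=
    (tendsto_iff_tendsto_subseq_of_antitone (h.antitone_energy hf hg hσ hτ hK h₀) hφ).2 hsub
  exact ⟨tendsto_of_norm_sub_sq_le henergy fun n => norm_fst_sub_sq_le_energy hσ hτ hK x₀ y₀ _ _ _,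
    tendsto_of_norm_sub_sq_le henergy fun n => norm_snd_sub_sq_le_energy hσ hτ hK x₀ y₀ _ _ _⟩

lemma exists_tendsto [FiniteDimensional ℝ X] [FiniteDimensional ℝ Y]
    (h : IsPrimalDualSeq f g K σ τ x xbar y) (hf : ProperConvexLsc f) (hg : ProperConvexLsc g)
    (hσ : 0 < σ) (hτ : 0 < τ) (hK : σ * τ * ‖K‖ ^ 2 < 1) (h₀ : IsSaddlePoint f g K x₀ y₀) :
    ∃ x₁ y₁, IsSaddlePoint f g K x₁ y₁ ∧ Tendsto x atTop (𝓝 x₁) ∧ Tendsto y atTop (𝓝 y₁) := by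
  have : ProperSpace X := FiniteDimensional.proper_real X
  have : ProperSpace Y := FiniteDimensional.proper_real Y
  obtain ⟨⟨x₁, y₁⟩, -, φ, hφ, hlim⟩ := tendsto_subseq_of_bounded
    (h.isBounded_range hf hg hσ hτ hK h₀) (x := fun n => (x n, y n)) Set.mem_range_self
  obtain ⟨hx, hy⟩ := Prod.tendsto_iff _ _ |>.1 hlim
  obtain ⟨hu, hw⟩ := h.tendsto_increments hf hg hσ hτ hK h₀
  have h₁ := h.isSaddlePoint_of_tendsto_subseq hf hg hσ.ne' hτ.ne' hu hw hφ.tendsto_atTop hx hy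
  exact ⟨x₁, y₁, h₁, h.tendsto_of_tendsto_subseq hf hg hσ hτ hK h₁ hφ.tendsto_atTop hx hy⟩

end IsPrimalDualSeq

end ConvexDuality

open ConvexDuality Filter Topology in
theorem theorem15 {X Y : Type*}
    [NormedAddCommGroup X] [InnerProductSpace ℝ X] [CompleteSpace X]
    [NormedAddCommGroup Y] [InnerProductSpace ℝ Y] [CompleteSpace Y]
    (f : X → EReal) (g : Y → EReal) (K : X →L[ℝ] Y)
    (hf : ProperConvexLsc f) (hg : ProperConvexLsc g)
    (xhat : X) (hxhat : IsPrimalOptimal f g K xhat)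
    (hQC : QC1 f g K ∨ QC2 f g K ∨ QC3 f g K) :
    -- (i)
    (∃ yhat : Y, IsDualOptimal f g K yhat ∧
      (⨅ x : X, primalObj f g K x) = (⨆ y : Y, dualObj f g K y) ∧
      K xhat ∈ subdiff (conj g) yhat ∧
      -(ContinuousLinearMap.adjoint K yhat) ∈ subdiff f xhat) ∧
    ∀ σ τ : ℝ, 0 < σ → 0 < τ → σ * τ * ‖K‖ ^ 2 < 1 →
      ∀ (x xbar : ℕ → X) (y : ℕ → Y), IsPrimalDualSeq f g K σ τ x xbar y →
        -- (ii)
        ((∀ yhat : Y, IsDualOptimal f g K yhat → ∀ n : ℕ,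
            ‖x n - xhat‖ ^ 2 / (2 * τ) +
                (1 - σ * τ * ‖K‖ ^ 2) * (‖y n - yhat‖ ^ 2 / (2 * σ)) ≤
              ‖x 0 - xhat‖ ^ 2 / (2 * τ) + ‖y 0 - yhat‖ ^ 2 / (2 * σ)) ∧
          Bornology.IsBounded (Set.range fun n => (x n, y n))) ∧
        -- (iii)
        (FiniteDimensional ℝ X → FiniteDimensional ℝ Y →
          (∃ xstar : X, IsPrimalOptimal f g K xstar ∧ Tendsto x atTop (𝓝 xstar)) ∧
          (∃ ystar : Y, IsDualOptimal f g K ystar ∧ Tendsto y atTop (𝓝 ystar))) := by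
  have hQC3 : QC3 f g K := by
    rcases hQC with h | h | h
    exacts [h.qc2.qc3, h.qc3, h]
  obtain ⟨y₀, h₀⟩ := exists_isSaddlePoint hf hg hQC3 hxhat
  refine ⟨⟨y₀, h₀.isDualOptimal hg, h₀.iInf_eq_iSup hg, h₀.2, h₀.1⟩,
    fun σ τ hσ hτ hK x xbar y h => ⟨⟨fun yhat hyhat => ?_, ?_⟩, fun _ _ => ?_⟩⟩
  · exact h.norm_sq_le hf hg hσ hτ hK (h₀.of_isDualOptimal hg hyhat)
  · exact h.isBounded_range hf hg hσ hτ hK h₀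
  · obtain ⟨x₁, y₁, h₁, hx, hy⟩ := h.exists_tendsto hf hg hσ hτ hK h₀
    exact ⟨⟨x₁, h₁.isPrimalOptimal hg, hx⟩, y₁, h₁.isDualOptimal hg, hy⟩
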